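/- **Theorem (convergence of cylindrical approximations to linear functional differential equations, Banach space case).** Let $X$ be a real Banach space with a Schauder basis $\{\varphi_k\}_{k\ge1}$ and coordinate functionals $a_k$, let $P_m\theta=\sum_{k=1}^m a_k(\theta)\varphi_k$ ($m=0,1,2,\dots$), and for a continuous functional $F:X\to\mathbb F$ ($\mathbb F=\mathbb R$ or $\mathbb C$) let $(B_mF)(\theta)=F(P_m\theta)$. Let $K\subseteq X$ be compact, and write $\|F\|_K=\max_{\theta\in K}|F(\theta)|$. Let $\mathcal F$ be a linear space of continuous functionals $X\to\mathbb F$ and, for each $m$, let $\mathcal F_m$ be a linear space of continuous cylindrical functionals (i.e. $G=B_mG$ for $G\in\mathcal F_m$) such that $B_m\mathcal F\subseteq\mathcal F_m$. Functionals are identified when they agree on $K$, and $\mathcal F$, $\mathcal F_m$ with the norm $\|\cdot\|_K$ are assumed to be Banach spaces. Let $\mathcal L$ be an operator in $\mathcal F$ (with domain $D(\mathcal L)$, possibly unbounded) which generates a strongly continuous semigroup $e^{t\mathcal L}$ on $\mathcal F$, so that the problem $\partial_tF=\mathcal LF$, $F(0)=F^0$, is well-posed with solution $F(\cdot,t)=e^{t\mathcal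 L}F^0$. For each $m$ let $\mathcal L_m$ be an operator in $\mathcal F_m$ which generates a strongly continuous semigroup $e^{t\mathcal L_m}$ on $\mathcal F_m$, and let $F_m(\cdot,t)=e^{t\mathcal L_m}F_m^0$ be the solution of $\partial_tF_m=\mathcal L_mF_m$, $F_m(0)=F_m^0\in\mathcal F_m$. Let $0<T<\infty$. We say that the approximation is * *stable* if there are constants $M,\omega$ independent of $m$ with $\|e^{t\mathcal L_m}\|\le Me^{\omega t}$ for all $t\ge0$ and all $m$; * *consistent* if for every $F\in D(\mathcal L)$ there are $F_m\in D(\mathcal L_m)$ with $\|F-F_m\|_K\to0$ and $\|\mathcal LF-\mathcal L_mF_m\|_K\to0$ as $m\to\infty$; * *convergent* if $$\max_{t\in[0,T]}\max_{\theta\in K}|F_m(\theta,t)-F(\theta,t)|\to0\qquad(m\to\infty)\qquad(*)$$ for all initial data $F^0\in\mathcal F$, $F_m^0\in\mathcal F_m$ such that $\|F_m^0-F^0\|_K\to0$. Then: 1. The approximation is stable and consistent if and only if it is convergent. 2. If it is stable and consistent, then in particular $(*)$ holds for every $F^0\in\mathcal F$ with the cylindrical initial data $F_m^0=B_mF^0$.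 3. Conversely, suppose that for all sufficiently large $m$ one has $\mathcal F_m\subseteq\mathcal F$ and $B_m$ is bounded on $\mathcal F$, i.e. $\|B_mF\|_K\le C_m\|F\|_K$ for all $F\in\mathcal F$ with some constant $C_m$. If $(*)$ holds for every $F^0\in\mathcal F$ with $F_m^0=B_mF^0$, then the approximation is stable and consistent. -/

import Mathlib

open Filter Topology TopologicalSpace
open scoped NNReal

noncomputable section

namespace FDE

/-! ### Strongly continuous semigroups and their generators -/

/-- A strongly continuous one-parameter semigroup `(S t)_{t ≥ 0}` of bounded linear operators. -/
structure C0Semigroup (𝕜 : Type*) [RCLike 𝕜] (E : Type*) [NormedAddCommGroup E]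
    [NormedSpace 𝕜 E] where
  /-- The operator at time `t`. -/
  op : ℝ≥0 → E →L[𝕜] E
  op_zero : op 0 = ContinuousLinearMap.id 𝕜 E
  op_add : ∀ s t : ℝ≥0, op (s + t) = (op s).comp (op t)
  continuous_op : ∀ x : E, Continuous fun t : ℝ≥0 => op t x

/-- The (possibly unbounded) operator `L` generates the semigroup `S`: the domain of `L` consists
of exactly those `x` for which `(S t x - x) / t` converges as `t → 0+`, and `L x` is the limit. -/
def C0Semigroup.IsGenerator {𝕜 : Type*} [RCLike 𝕜] {E : Type*} [NormedAddCommGroup E]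
    [NormedSpace 𝕜 E] (S : C0Semigroup 𝕜 E) (L : E →ₗ.[𝕜] E) : Prop :=
  ∀ x y : E, (x, y) ∈ L.graph ↔
    Tendsto (fun t : ℝ≥0 => (((t : ℝ) : 𝕜))⁻¹ • (S.op t x - x)) (𝓝[>] 0) (𝓝 y)

/-! ### Spaces of functionals and cylindrical approximations -/

section Functionals

variable {𝕜 : Type*} [RCLike 𝕜] {X : Type*} [NormedAddCommGroup X] [NormedSpace ℝ X]

/-- Restriction of continuous functionals on `X` to the compact set `K`, as a linear map into
`C(K, 𝕜)` with the maximum norm. -/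
def restrictL (𝕜 : Type*) [RCLike 𝕜] (K : Compacts X) : C(X, 𝕜) →ₗ[𝕜] C(K, 𝕜) where
  toFun F := F.restrict (K : Set X)
  map_add' _ _ := rfl
  map_smul' _ _ := rfl

/-- The functionals belonging to `A`, considered on the compact set `K`, with the norm
`max_{θ ∈ K} |F θ|`. -/
abbrev OnCompact (K : Compacts X) (A : Submodule 𝕜 C(X, 𝕜)) : Submodule 𝕜 C(K, 𝕜) :=
  A.map (restrictL 𝕜 K)

/-- An element of `A`, considered on the compact set `K`. -/
def toOnCompact (K : Compacts X) (A : Submodule 𝕜 C(X, 𝕜)) (F : C(X, 𝕜)) (hF : F ∈ A) :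
    OnCompact K A :=
  ⟨restrictL 𝕜 K F, Submodule.mem_map_of_mem hF⟩

/-- The projection `P_m θ = ∑_{k < m} a_k(θ) φ_k` onto the span of the first `m` basis elements,
where `a_k` are the coordinate functionals of the basis. -/
def basisProj (b : SchauderBasis ℝ X) (m : ℕ) : X →L[ℝ] X :=
  ∑ k ∈ Finset.range m, (b.coord k).smulRight (b k)

/-- The cylindrical approximation `(B_m F)(θ) = F (P_m θ)`. -/
def cylApprox (b : SchauderBasis ℝ X) (m : ℕ) (F : C(X, 𝕜)) : C(X, 𝕜) :=
  F.comp (basisProj b m : C(X, X))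

end Functionals

/-! ### Stability, consistency, convergence -/

/-- Stability: `‖S_m(t)‖ ≤ M e^{ω t}` with constants independent of `m`. -/
def Stable {𝕜 : Type*} [RCLike 𝕜] {E : ℕ → Type*} [∀ m, NormedAddCommGroup (E m)]
    [∀ m, NormedSpace 𝕜 (E m)] (S : ∀ m, C0Semigroup 𝕜 (E m)) : Prop :=
  ∃ M ω : ℝ, ∀ (m : ℕ) (t : ℝ≥0), ‖(S m).op t‖ ≤ M * Real.exp (ω * t)

section OnK

variable {𝕜 : Type*} [RCLike 𝕜] {X : Type*} [NormedAddCommGroup X] [NormedSpace ℝ X]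
  {K : Compacts X} {A : Submodule 𝕜 C(X, 𝕜)} {Am : ℕ → Submodule 𝕜 C(X, 𝕜)}

/-- Consistency: for every `F ∈ D(L)` there are `F_m ∈ D(L_m)` with `‖F - F_m‖ → 0` and
`‖L F - L_m F_m‖ → 0`, in the norm of uniform convergence on `K`. -/
def Consistent (L : OnCompact K A →ₗ.[𝕜] OnCompact K A)
    (Lm : ∀ m, OnCompact K (Am m) →ₗ.[𝕜] OnCompact K (Am m)) : Prop :=
  ∀ F : L.domain, ∃ Fm : ∀ m, (Lm m).domain,
    Tendsto (fun m => ‖((F : OnCompact K A) : C(K, 𝕜)) -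
      ((Fm m : OnCompact K (Am m)) : C(K, 𝕜))‖) atTop (𝓝 0) ∧
    Tendsto (fun m => ‖((L F : OnCompact K A) : C(K, 𝕜)) -
      ((Lm m (Fm m) : OnCompact K (Am m)) : C(K, 𝕜))‖) atTop (𝓝 0)

/-- The solutions `F_m(θ, t) = (S_m(t) F_m⁰)(θ)` converge to the solution
`F(θ, t) = (S(t) F⁰)(θ)` uniformly in `(t, θ) ∈ [0, T] × K`. -/
def SolutionsConverge (T : ℝ≥0) (S : C0Semigroup 𝕜 (OnCompact K A))
    (Sm : ∀ m, C0Semigroup 𝕜 (OnCompact K (Am m)))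
    (F0 : OnCompact K A) (Fm0 : ∀ m, OnCompact K (Am m)) : Prop :=
  TendstoUniformlyOn
    (fun (m : ℕ) (p : ℝ≥0 × K) => ((Sm m).op p.1 (Fm0 m) : C(K, 𝕜)) p.2)
    (fun p : ℝ≥0 × K => (S.op p.1 F0 : C(K, 𝕜)) p.2)
    atTop (Set.Icc 0 T ×ˢ Set.univ)

/-- Convergence of the approximation: the solutions converge uniformly on `[0, T] × K` whenever
the initial data `F_m⁰` converge to `F⁰` uniformly on `K`. -/
def Convergent (T : ℝ≥0) (S : C0Semigroup 𝕜 (OnCompact K A))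
    (Sm : ∀ m, C0Semigroup 𝕜 (OnCompact K (Am m))) : Prop :=
  ∀ (F0 : OnCompact K A) (Fm0 : ∀ m, OnCompact K (Am m)),
    Tendsto (fun m => ‖(Fm0 m : C(K, 𝕜)) - (F0 : C(K, 𝕜))‖) atTop (𝓝 0) →
    SolutionsConverge T S Sm F0 Fm0

/-- Convergence for the cylindrical initial data `F_m⁰ = B_m F⁰`, for every `F⁰` in the space. -/
def CylConvergent (b : SchauderBasis ℝ X) (hB : ∀ m, ∀ F ∈ A, cylApprox b m F ∈ Am m)
    (T : ℝ≥0) (S : C0Semigroup 𝕜 (OnCompact K A))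
    (Sm : ∀ m, C0Semigroup 𝕜 (OnCompact K (Am m))) : Prop :=
  ∀ (F0 : C(X, 𝕜)) (hF0 : F0 ∈ A),
    SolutionsConverge T S Sm (toOnCompact K A F0 hF0)
      (fun m => toOnCompact K (Am m) (cylApprox b m F0) (hB m F0 hF0))

end OnK

end FDE

end

/-! This is the Lax equivalence principle for semigroups on varying subspaces `V`, `Vm m` of one
normed space `Z`, here `C(K, 𝕜)`. Stability and consistency give convergence by a direct polygon
argument, without resolvents. For `F` in the domain and a small fixed step `h`, the finitely many
points `S (k h) F` also lie in the domain, so consistency supplies points `v k` in the domain of the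
generator of `Sm m` close to them together with their images. One step of `Sm m` then carries `v k`
to `v (k + 1)` up to `O(δ h)` (`InGraph.norm_op_sub_le`); stability adds these errors up to `O(δ
T)`, and density of the domain handles general data. Conversely, time averages over `[0, h]` of
converging orbits lie in the domains and have difference quotients as images, which gives
consistency (`graphConsistent_of_orbitsConverge`). Stability on `[0, T]` comes from rescaling a bad
sequence into null data, or, for cylindrical data, from Banach–Steinhaus applied to the operators
`Sm m t ∘ B m`; the semigroup law extends it to all times. -/

namespace FDE

/-! ### Semigroups and their generators -/

namespace C0Semigroup

variable {𝕜 : Type*} [RCLike 𝕜] {E : Type*} [NormedAddCommGroup E] [NormedSpace 𝕜 E]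
  (S : C0Semigroup 𝕜 E)

/-- `(x, y)` lies in the graph of the infinitesimal generator of `S`. -/
def InGraph (x y : E) : Prop :=
  Tendsto (fun t : ℝ≥0 => (((t : ℝ) : 𝕜))⁻¹ • (S.op t x - x)) (𝓝[>] 0) (𝓝 y)

lemma op_zero_apply (x : E) : S.op 0 x = x := by simp [S.op_zero]

lemma op_add_apply (s t : ℝ≥0) (x : E) : S.op (s + t) x = S.op s (S.op t x) := by
  simp [S.op_add]

lemma op_comm_apply (s t : ℝ≥0) (x : E) : S.op s (S.op t x) = S.op t (S.op s x) := by
  rw [← op_add_apply, ← op_add_apply, add_comm]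

/-- The operators `S t`, `t ∈ [0, T]`, are uniformly bounded. -/
lemma exists_norm_op_le [CompleteSpace E] (T : ℝ≥0) :
    ∃ C : ℝ, ∀ t ≤ T, ‖S.op t‖ ≤ C := by
  have h : ∃ C : ℝ, ∀ t : Set.Icc (0 : ℝ≥0) T, ‖S.op t‖ ≤ C := by
    refine banach_steinhaus fun x => ?_
    obtain ⟨C, hC⟩ := (isCompact_Icc (a := (0 : ℝ≥0)) (b := T)).exists_bound_of_continuousOn
      (S.continuous_op x).continuousOn
    exact ⟨C, fun t => hC t t.2⟩
  obtain ⟨C, hC⟩ := h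
  exact ⟨C, fun t ht => hC ⟨t, zero_le, ht⟩⟩

/-- A bound on `[0, T]` gives an exponential bound on `[0, ∞)`, uniform in the semigroup. -/
lemma norm_op_le_exp {T : ℝ≥0} (hT : 0 < T) {C : ℝ} (hC : 1 ≤ C)
    (h : ∀ t ≤ T, ‖S.op t‖ ≤ C) (t : ℝ≥0) :
    ‖S.op t‖ ≤ C * Real.exp (Real.log C / T * t) := by
  have key : ∀ (n : ℕ), ∀ s ≤ T, ‖S.op (n * T + s)‖ ≤ C ^ (n + 1) := by
    intro n
    induction n with
    | zero => intro s hs; simpa using h s hs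
    | succ n ih =>
      intro s hs
      have : ((n + 1 : ℕ) : ℝ≥0) * T + s = T + (n * T + s) := by push_cast; ring
      rw [this, S.op_add, pow_succ']
      exact (ContinuousLinearMap.opNorm_comp_le _ _).trans
        (mul_le_mul (h T le_rfl) (ih s hs) (norm_nonneg _) (by linarith))
  have hT' : (0 : ℝ) < T := hT
  -- With `n = ⌊t / T⌋₊` and remainder at most `T`, the bound `C ^ (n + 1)` is at most `C * C ^ (t /
  -- T)`, since `1 ≤ C`.
  have h1 : (⌊t / T⌋₊ : ℝ≥0) * T ≤ t := by
    rw [← le_div_iff₀ hT]; exact Nat.floor_le zero_le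
  have h2 : t ≤ ⌊t / T⌋₊ * T + T := by
    have := (Nat.lt_floor_add_one (t / T)).le
    rw [div_le_iff₀ hT] at this
    linarith [this, add_mul (⌊t / T⌋₊ : ℝ≥0) 1 T]
  have h3 : t = ⌊t / T⌋₊ * T + (t - ⌊t / T⌋₊ * T) := (add_tsub_cancel_of_le h1).symm
  have h4 := key ⌊t / T⌋₊ (t - ⌊t / T⌋₊ * T) (tsub_le_iff_left.2 h2)
  rw [← h3, pow_succ'] at h4
  refine h4.trans (mul_le_mul_of_nonneg_left ?_ (by linarith))
  rw [← Real.exp_log (show 0 < C by linarith), ← Real.exp_nat_mul, Real.exp_log (by linarith)]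
  apply Real.exp_le_exp.2
  have h5 : (⌊t / T⌋₊ : ℝ) * T ≤ t := by exact_mod_cast h1
  have h6 : (⌊t / T⌋₊ : ℝ) ≤ t / T := by rwa [le_div_iff₀ hT']
  calc (⌊t / T⌋₊ : ℝ) * Real.log C ≤ t / T * Real.log C :=
        mul_le_mul_of_nonneg_right h6 (Real.log_nonneg hC)
    _ = _ := by ring

variable {S}

lemma InGraph.sub {x y x' y' : E} (h : S.InGraph x y) (h' : S.InGraph x' y') :
    S.InGraph (x - x') (y - y') := by
  refine (Tendsto.sub h h').congr fun t => ?_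
  rw [map_sub, ← smul_sub]; congr 1; abel

lemma InGraph.smul {x y : E} (h : S.InGraph x y) (c : 𝕜) : S.InGraph (c • x) (c • y) := by
  refine (Tendsto.const_smul h c).congr fun t => ?_
  rw [map_smul, ← smul_sub, smul_comm]

lemma InGraph.op {x y : E} (h : S.InGraph x y) (s : ℝ≥0) :
    S.InGraph (S.op s x) (S.op s y) := by
  refine (((S.op s).continuous.tendsto y).comp h).congr fun t => ?_
  simp only [Function.comp, map_smul, map_sub]
  rw [op_comm_apply]

lemma continuous_op_toNNReal (x : E) : Continuous fun t : ℝ => S.op t.toNNReal x :=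
  (S.continuous_op x).comp continuous_real_toNNReal

lemma tendsto_toNNReal_sub (t : ℝ) :
    Tendsto (fun y : ℝ => (y - t).toNNReal) (𝓝[>] t) (𝓝[>] 0) := by
  refine tendsto_nhdsWithin_iff.2 ⟨?_, ?_⟩
  · have : Continuous fun y : ℝ => (y - t).toNNReal := by fun_prop
    simpa using (this.tendsto t).mono_left nhdsWithin_le_nhds
  · filter_upwards [self_mem_nhdsWithin] with y hy
    simpa using hy

section Real

variable [NormedSpace ℝ E] [IsScalarTower ℝ 𝕜 E]

lemma op_real_smul (S : C0Semigroup 𝕜 E) (t : ℝ≥0) (r : ℝ) (x : E) :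
    S.op t (r • x) = r • S.op t x := by
  rw [RCLike.real_smul_eq_coe_smul (K := 𝕜), map_smul, ← RCLike.real_smul_eq_coe_smul]

/-- The increment after `t` is `S t (S (r - t) x - x)`, so only the limit at `0+` is used. A right
derivative suffices for the mean value inequality. -/
lemma InGraph.hasDerivWithinAt {x y : E} (h : S.InGraph x y) {t : ℝ} (ht : 0 ≤ t) :
    HasDerivWithinAt (fun r : ℝ => S.op r.toNNReal x) (S.op t.toNNReal y) (Set.Ici t) t := by
  rw [hasDerivWithinAt_iff_tendsto_slope, Set.Ici_sdiff_left]
  have h1 := ((S.op t.toNNReal).continuous.tendsto y).comp (h.comp (tendsto_toNNReal_sub t))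
  refine h1.congr' ?_
  filter_upwards [self_mem_nhdsWithin] with r hr
  have hr' : 0 ≤ r - t := sub_nonneg.2 (le_of_lt hr)
  have h2 : r.toNNReal = t.toNNReal + (r - t).toNNReal := by
    rw [← Real.toNNReal_add ht hr']; simp
  simp only [Function.comp, slope, vsub_eq_sub]
  rw [h2, op_add_apply, map_smul, map_sub, Real.coe_toNNReal _ hr',
    RCLike.real_smul_eq_coe_smul (K := 𝕜)]
  push_cast
  rfl

/-- If `b - a ≈ h • L a` and `L b ≈ L a`, then `b ≈ S h a`. -/
lemma InGraph.norm_op_sub_le_aux {a a' b b' : E} (ha : S.InGraph a a') (hb : S.InGraph b b')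
    {h : ℝ≥0} (hh : 0 < h) {C ε₁ ε₂ : ℝ} (hC : ∀ t ≤ h, ‖S.op t‖ ≤ C)
    (h₁ : ‖b - a - ((h : ℝ) : 𝕜) • a'‖ ≤ ε₁ * h) (h₂ : ‖b' - a'‖ ≤ ε₂) :
    ‖S.op h a - b‖ ≤ C * (ε₁ + ε₂) * h := by
  have hh' : (0 : ℝ) < h := hh
  have hC0 : 0 ≤ C := (norm_nonneg _).trans (hC 0 zero_le)
  set c : E := (h : ℝ)⁻¹ • (b - a) with hc
  set c' : E := (h : ℝ)⁻¹ • (b' - a') with hc'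
  have hcc : S.InGraph c c' := by
    have := (hb.sub ha).smul (((h : ℝ)⁻¹ : ℝ) : 𝕜)
    rwa [← RCLike.real_smul_eq_coe_smul, ← RCLike.real_smul_eq_coe_smul] at this
  -- Apply `S r` to the point `b - r c` of the segment from `b` to `a`: then `g 0 = b` and `g h = S
  -- h a`, so a bound on `g'` bounds the one-step error.
  let g : ℝ → E := fun r => S.op r.toNNReal b - r • S.op r.toNNReal c
  let g' : ℝ → E := fun r => S.op r.toNNReal b' -
    (r • S.op r.toNNReal c' + (1 : ℝ) • S.op r.toNNReal c)
  have hg : Continuous g :=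
    (continuous_op_toNNReal b).sub (continuous_id.smul (continuous_op_toNNReal c))
  have hg' : ∀ r ∈ Set.Ico (0 : ℝ) h, HasDerivWithinAt g (g' r) (Set.Ici r) r := fun r hr =>
    (hb.hasDerivWithinAt hr.1).sub ((hasDerivWithinAt_id r _).smul (hcc.hasDerivWithinAt hr.1))
  have hbound : ∀ r ∈ Set.Ico (0 : ℝ) h, ‖g' r‖ ≤ C * (ε₁ + ε₂) := by
    intro r hr
    have e1 : g' r = S.op r.toNNReal (b' - r • c' - c) := by
      simp only [g', map_sub, one_smul]
      rw [op_real_smul S r.toNNReal r c']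
      abel
    -- The factor `1 / h` hidden in `c'` is harmless because it is multiplied by `r ≤ h`; what
    -- remains is a convex weight times `b' - a'`, minus the scaled Euler defect.
    have e2 : b' - r • c' - c =
        (1 - r / h) • (b' - a') - (h : ℝ)⁻¹ • (b - a - (h : ℝ) • a') := by
      rw [smul_sub _ (b - a), inv_smul_smul₀ hh'.ne', ← hc, sub_smul, div_eq_mul_inv, mul_smul,
        ← hc', one_smul]
      abel
    have hr0 : 0 ≤ r / h := div_nonneg hr.1 hh'.le
    have hr1 : r / h ≤ 1 := (div_le_one hh').2 hr.2.le
    have e3 : ‖b' - r • c' - c‖ ≤ ε₁ + ε₂ := by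
      rw [e2]
      refine (norm_sub_le _ _).trans ?_
      rw [norm_smul, norm_smul, Real.norm_of_nonneg (by linarith), norm_inv,
        Real.norm_of_nonneg hh'.le]
      rw [← RCLike.real_smul_eq_coe_smul] at h₁
      have : (h : ℝ)⁻¹ * ‖b - a - (h : ℝ) • a'‖ ≤ ε₁ := by
        rw [inv_mul_le_iff₀ hh']; linarith
      nlinarith [norm_nonneg (b' - a')]
    rw [e1]
    refine ((S.op _).le_opNorm _).trans (mul_le_mul (hC _ ?_) e3 (norm_nonneg _) hC0)
    exact Real.toNNReal_le_iff_le_coe.2 hr.2.le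
  have := norm_image_sub_le_of_norm_deriv_right_le_segment hg.continuousOn hg' hbound h
    ⟨hh'.le, le_rfl⟩
  have e4 : g h = S.op h a := by
    simp only [g, Real.toNNReal_coe]
    rw [← op_real_smul, hc, smul_inv_smul₀ hh'.ne', ← map_sub]
    simp
  have e5 : g 0 = b := by simp [g, op_zero_apply]
  simpa [e4, e5] using this

lemma InGraph.norm_op_sub_self_le_aux {a a' : E} (ha : S.InGraph a a') {h : ℝ≥0} {C : ℝ}
    (hC : ∀ t ≤ h, ‖S.op t‖ ≤ C) : ‖S.op h a - a‖ ≤ C * ‖a'‖ * h := by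
  have := norm_image_sub_le_of_norm_deriv_right_le_segment (a := 0) (b := (h : ℝ))
    (C := C * ‖a'‖) (continuous_op_toNNReal (S := S) a).continuousOn
    (fun r hr => ha.hasDerivWithinAt hr.1)
    (fun r hr => ((S.op _).le_opNorm _).trans (mul_le_mul_of_nonneg_right
      (hC _ (Real.toNNReal_le_iff_le_coe.2 hr.2.le)) (norm_nonneg _))) h ⟨h.2, le_rfl⟩
  simpa [op_zero_apply] using this

/-- Time averages of orbits lie in the domain of the generator. -/
lemma exists_inGraph_near_aux [CompleteSpace E] (S : C0Semigroup 𝕜 E) (x : E) {h : ℝ≥0}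
    (hh : 0 < h) {η : ℝ} (hη : ∀ s ≤ h, ‖S.op s x - x‖ ≤ η) :
    ∃ y, ‖y - x‖ ≤ η ∧ S.InGraph y ((((h : ℝ) : 𝕜))⁻¹ • (S.op h x - x)) := by
  have hh' : (0 : ℝ) < h := hh
  set f : ℝ → E := fun r => S.op r.toNNReal x with hf
  have fc : Continuous f := continuous_op_toNNReal x
  have fi : ∀ a b, IntervalIntegrable f MeasureTheory.volume a b :=
    fun a b => fc.intervalIntegrable a b
  have hint : S.InGraph (∫ r in (0 : ℝ)..h, f r) (S.op h x - x) := by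
    -- For `t ≥ 0` this is `S t` applied to the integral, by translation of the variable; the
    -- fundamental theorem of calculus gives its derivative at `0`.
    let Φ : ℝ → E := fun t => (∫ r in (0 : ℝ)..(h + t), f r) - ∫ r in (0 : ℝ)..t, f r
    have hΦ : HasDerivAt Φ (f h - f 0) 0 := by
      have h1 : HasDerivAt (fun t : ℝ => ∫ r in (0 : ℝ)..(h + t), f r) (f h) 0 := by
        have := (fc.integral_hasStrictDerivAt 0 (h + 0)).hasDerivAt.scomp (0 : ℝ)
          ((hasDerivAt_id (0 : ℝ)).const_add (h : ℝ))
        simpa [Function.comp_def] using this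
      exact h1.sub (fc.integral_hasStrictDerivAt 0 0).hasDerivAt
    have h2 : Tendsto (fun t : ℝ≥0 => (t : ℝ)⁻¹ • (Φ (0 + t) - Φ 0)) (𝓝[>] 0)
        (𝓝 (f h - f 0)) := by
      refine (hΦ.tendsto_slope_zero).comp ?_
      refine tendsto_nhdsWithin_iff.2 ⟨?_, ?_⟩
      · exact (NNReal.continuous_coe.tendsto' 0 0 rfl).mono_left nhdsWithin_le_nhds
      · filter_upwards [self_mem_nhdsWithin] with t ht
        have : (0 : ℝ) < t := ht
        simpa using this.ne'
    have e0 : f h - f 0 = S.op h x - x := by simp [hf, op_zero_apply]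
    rw [e0] at h2
    refine h2.congr fun t => ?_
    have e1 : S.op t (∫ r in (0 : ℝ)..h, f r) = ∫ r in (t : ℝ)..(h + t), f r := by
      have e2 := ((S.op t).restrictScalars ℝ).intervalIntegral_comp_comm (fi 0 h)
      simp only [ContinuousLinearMap.coe_restrictScalars'] at e2
      rw [← e2]
      have e3 := intervalIntegral.integral_comp_add_right (a := 0) (b := (h : ℝ)) f (t : ℝ)
      rw [zero_add] at e3
      rw [← e3]
      refine intervalIntegral.integral_congr fun r hr => ?_
      rw [Set.uIcc_of_le hh'.le] at hr
      simp only [hf]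
      rw [← op_add_apply, add_comm, ← Real.toNNReal_coe (r := t), ← Real.toNNReal_add hr.1
        (NNReal.coe_nonneg _), Real.toNNReal_coe]
    rw [e1, RCLike.real_smul_eq_coe_smul (K := 𝕜)]
    push_cast
    congr 1
    simp only [Φ, zero_add, add_zero, intervalIntegral.integral_same, sub_zero]
    rw [intervalIntegral.integral_interval_sub_left (fi _ _) (fi _ _)]
  refine ⟨(h : ℝ)⁻¹ • ∫ r in (0 : ℝ)..h, f r, ?_, ?_⟩
  · have e1 : (h : ℝ)⁻¹ • (∫ r in (0 : ℝ)..h, f r) - x =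
        (h : ℝ)⁻¹ • ∫ r in (0 : ℝ)..h, (f r - x) := by
      rw [intervalIntegral.integral_sub (fi _ _) (by simp), smul_sub]
      simp [smul_smul, hh'.ne']
    have e2 : ‖∫ r in (0 : ℝ)..h, (f r - x)‖ ≤ η * |(h : ℝ) - 0| := by
      refine intervalIntegral.norm_integral_le_of_norm_le_const fun r hr => ?_
      rw [Set.uIoc_of_le hh'.le] at hr
      exact hη _ (Real.toNNReal_le_iff_le_coe.2 hr.2)
    rw [e1, norm_smul, norm_inv, Real.norm_of_nonneg hh'.le, inv_mul_le_iff₀ hh']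
    rw [sub_zero, abs_of_pos hh'] at e2
    linarith
  · have := hint.smul (((h : ℝ)⁻¹ : ℝ) : 𝕜)
    rw [← RCLike.real_smul_eq_coe_smul] at this
    simpa using this

end Real

/-- Derivatives and integrals need a real structure, which is obtained here by restricting scalars,
so that it does not enter the statement. -/
lemma InGraph.norm_op_sub_le {a a' b b' : E} (ha : S.InGraph a a') (hb : S.InGraph b b')
    {h : ℝ≥0} (hh : 0 < h) {C ε₁ ε₂ : ℝ} (hC : ∀ t ≤ h, ‖S.op t‖ ≤ C)
    (h₁ : ‖b - a - ((h : ℝ) : 𝕜) • a'‖ ≤ ε₁ * h) (h₂ : ‖b' - a'‖ ≤ ε₂) :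
    ‖S.op h a - b‖ ≤ C * (ε₁ + ε₂) * h := by
  let _ : NormedSpace ℝ E := NormedSpace.restrictScalars ℝ 𝕜 E
  have : IsScalarTower ℝ 𝕜 E := IsScalarTower.restrictScalars ℝ 𝕜 E
  exact ha.norm_op_sub_le_aux hb hh hC h₁ h₂

lemma InGraph.norm_op_sub_self_le {a a' : E} (ha : S.InGraph a a') {h : ℝ≥0} {C : ℝ}
    (hC : ∀ t ≤ h, ‖S.op t‖ ≤ C) : ‖S.op h a - a‖ ≤ C * ‖a'‖ * h := by
  let _ : NormedSpace ℝ E := NormedSpace.restrictScalars ℝ 𝕜 E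
  have : IsScalarTower ℝ 𝕜 E := IsScalarTower.restrictScalars ℝ 𝕜 E
  exact ha.norm_op_sub_self_le_aux hC

lemma exists_inGraph_near [CompleteSpace E] (S : C0Semigroup 𝕜 E) (x : E) {h : ℝ≥0}
    (hh : 0 < h) {η : ℝ} (hη : ∀ s ≤ h, ‖S.op s x - x‖ ≤ η) :
    ∃ y, ‖y - x‖ ≤ η ∧ S.InGraph y ((((h : ℝ) : 𝕜))⁻¹ • (S.op h x - x)) := by
  let _ : NormedSpace ℝ E := NormedSpace.restrictScalars ℝ 𝕜 E
  have : IsScalarTower ℝ 𝕜 E := IsScalarTower.restrictScalars ℝ 𝕜 E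
  exact exists_inGraph_near_aux S x hh hη

/-- Strong continuity at `0`, in `ε`-`δ` form. -/
lemma exists_norm_op_sub_le (S : C0Semigroup 𝕜 E) (x : E) {δ : ℝ} (hδ : 0 < δ) :
    ∃ r : ℝ≥0, 0 < r ∧ ∀ s ≤ r, ‖S.op s x - x‖ ≤ δ := by
  obtain ⟨r, hr, h⟩ := Metric.continuous_iff.1 (S.continuous_op x) 0 δ hδ
  refine ⟨(r / 2).toNNReal, by simpa using hr, fun s hs => ?_⟩
  have : dist s 0 < r := by
    rw [NNReal.dist_eq]
    have : (s : ℝ) ≤ r / 2 := (Real.le_toNNReal_iff_coe_le (by linarith)).1 hs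
    simp only [NNReal.coe_zero, sub_zero, NNReal.abs_eq]
    linarith
  have := h s this
  rw [op_zero_apply, dist_eq_norm] at this
  exact this.le

lemma InGraph.exists_norm_quotient_sub_le {x y : E} (hx : S.InGraph x y) {δ : ℝ} (hδ : 0 < δ) :
    ∃ r : ℝ≥0, 0 < r ∧ ∀ s, 0 < s → s ≤ r → ‖(((s : ℝ) : 𝕜))⁻¹ • (S.op s x - x) - y‖ ≤ δ := by
  have h1 := (Metric.tendsto_nhds.1 hx) δ hδ
  rw [eventually_nhdsWithin_iff] at h1
  obtain ⟨r, hr, h⟩ := Metric.eventually_nhds_iff.1 h1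
  refine ⟨(r / 2).toNNReal, by simpa using hr, fun s hs0 hs => ?_⟩
  have : dist s 0 < r := by
    rw [NNReal.dist_eq]
    have : (s : ℝ) ≤ r / 2 := (Real.le_toNNReal_iff_coe_le (by linarith)).1 hs
    simp only [NNReal.coe_zero, sub_zero, NNReal.abs_eq]
    linarith
  have := h this hs0
  rw [dist_eq_norm] at this
  exact this.le

lemma exists_inGraph_norm_sub_le [CompleteSpace E] (S : C0Semigroup 𝕜 E) (x : E) {δ : ℝ}
    (hδ : 0 < δ) : ∃ y y', S.InGraph y y' ∧ ‖y - x‖ ≤ δ := by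
  obtain ⟨r, hr, h⟩ := S.exists_norm_op_sub_le x hδ
  obtain ⟨y, hy, hy'⟩ := S.exists_inGraph_near x hr h
  exact ⟨y, _, hy', hy⟩

/-- Accumulation of one-step errors. -/
lemma norm_op_mul_sub_le (S : C0Semigroup 𝕜 E) {T h : ℝ≥0} {C η : ℝ}
    (hC : ∀ t ≤ T, ‖S.op t‖ ≤ C) (k : ℕ) (hk : k * h ≤ T) (v : ℕ → E)
    (hv : ∀ j < k, ‖S.op h (v j) - v (j + 1)‖ ≤ η) :
    ‖S.op (k * h) (v 0) - v k‖ ≤ k * (C * η) := by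
  induction k generalizing v with
  | zero => simp [op_zero_apply]
  | succ k ih =>
    have hkT : k * h ≤ T := le_trans (by gcongr; simp) hk
    have h1 := ih hkT (fun j => v (j + 1)) fun j hj => hv (j + 1) (by omega)
    have e : ((k + 1 : ℕ) : ℝ≥0) * h = k * h + h := by push_cast; ring
    rw [e, op_add_apply]
    -- Peeling off the first step lets a single operator of norm at most `C` act on each local
    -- error, so no power `C ^ k` appears.
    have e2 : S.op (k * h) (S.op h (v 0)) - v (k + 1) =
        S.op (k * h) (S.op h (v 0) - v 1) + (S.op (k * h) (v 1) - v (k + 1)) := by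
      rw [map_sub]; abel
    rw [e2]
    have h2 : ‖S.op (k * h) (S.op h (v 0) - v 1)‖ ≤ C * η :=
      ((S.op _).le_opNorm _).trans (mul_le_mul (hC _ hkT) (hv 0 (by omega)) (norm_nonneg _)
        ((norm_nonneg _).trans (hC 0 zero_le)))
    refine (norm_add_le _ _).trans ?_
    push_cast
    simp only [zero_add] at h1
    linarith

end C0Semigroup

end FDE

/-! ### Abstract approximation on varying subspaces -/

namespace FDE

/-- An eventual uniform bound together with individual bounds gives a uniform bound. -/
lemma exists_bound_of_eventually {ι : Type*} {f : ℕ → ι → ℝ}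
    (h : ∃ C, ∀ᶠ m in atTop, ∀ i, f m i ≤ C) (h' : ∀ m, ∃ C, ∀ i, f m i ≤ C) :
    ∃ C, ∀ m i, f m i ≤ C := by
  obtain ⟨C, hC⟩ := h
  obtain ⟨N, hN⟩ := eventually_atTop.1 hC
  choose c hc using h'
  have h0 : 0 ≤ ∑ m ∈ Finset.range N, |c m| := Finset.sum_nonneg fun _ _ => abs_nonneg _
  refine ⟨|C| + ∑ m ∈ Finset.range N, |c m|, fun m i => ?_⟩
  rcases le_or_gt N m with hm | hm
  · linarith [hN m hm i, le_abs_self C]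
  · have := Finset.single_le_sum (f := fun m => |c m|) (fun _ _ => abs_nonneg _)
      (Finset.mem_range.2 hm)
    linarith [hc m i, le_abs_self (c m), abs_nonneg C]

/-- If for every `ε > 0` the values of `d m` eventually get below `ε`, then some choice of
points has `d m (a m) → 0`. -/
lemma exists_seq_tendsto_zero {α : ℕ → Type*} [∀ m, Nonempty (α m)] (d : ∀ m, α m → ℝ)
    (hd : ∀ m a, 0 ≤ d m a) (h : ∀ ε > 0, ∀ᶠ m in atTop, ∃ a, d m a ≤ ε) :
    ∃ a : ∀ m, α m, Tendsto (fun m => d m (a m)) atTop (𝓝 0) := by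
  have h1 : ∀ m, ∃ a, d m a < (⨅ a, d m a) + 1 / ((m : ℝ) + 1) := fun m =>
    exists_lt_of_ciInf_lt (lt_add_of_pos_right _ (by positivity))
  choose a ha using h1
  have h2 : Tendsto (fun m => (⨅ a, d m a)) atTop (𝓝 0) := by
    refine tendsto_order.2 ⟨fun e he => Eventually.of_forall fun m =>
      he.trans_le (Real.iInf_nonneg (hd m)), fun e he => ?_⟩
    filter_upwards [h (e / 2) (half_pos he)] with m ⟨a, ha⟩
    exact (ciInf_le ⟨0, by rintro _ ⟨a, rfl⟩; exact hd m a⟩ a).trans_lt (by linarith)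
  refine ⟨a, squeeze_zero (fun m => hd m _) (fun m => (ha m).le) ?_⟩
  simpa using h2.add tendsto_one_div_add_atTop_nhds_zero_nat

section Approximation

variable {𝕜 : Type*} [RCLike 𝕜] {Z : Type*} [NormedAddCommGroup Z] [NormedSpace 𝕜 Z]
  {V : Submodule 𝕜 Z} {Vm : ℕ → Submodule 𝕜 Z}

/-- The orbits of `F0m m` converge to the orbit of `F0` uniformly on `[0, T]`. -/
def OrbitsConverge (T : ℝ≥0) (S : C0Semigroup 𝕜 V) (Sm : ∀ m, C0Semigroup 𝕜 (Vm m))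
    (F0 : V) (F0m : ∀ m, Vm m) : Prop :=
  ∀ ε > 0, ∀ᶠ m in atTop, ∀ t ≤ T, ‖((Sm m).op t (F0m m) : Z) - (S.op t F0 : Z)‖ ≤ ε

/-- Every element of the graph of the generator of `S` is a limit of elements of the graphs of
the generators of `Sm m`. -/
def GraphConsistent (S : C0Semigroup 𝕜 V) (Sm : ∀ m, C0Semigroup 𝕜 (Vm m)) : Prop :=
  ∀ F F' : V, S.InGraph F F' → ∃ p p' : ∀ m, Vm m, (∀ m, (Sm m).InGraph (p m) (p' m)) ∧
    Tendsto (fun m => ‖(F : Z) - (p m : Z)‖) atTop (𝓝 0) ∧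
    Tendsto (fun m => ‖(F' : Z) - (p' m : Z)‖) atTop (𝓝 0)

variable {T : ℝ≥0} {S : C0Semigroup 𝕜 V} {Sm : ∀ m, C0Semigroup 𝕜 (Vm m)}

/-- A finite-time error estimate for stable approximations, comparing with the polygon through
the points `v k ≈ S (k h) F`. -/
lemma norm_op_sub_op_le {W : Submodule 𝕜 Z} (R : C0Semigroup 𝕜 W) {C δ : ℝ} (hC1 : 1 ≤ C)
    (hδ : 0 < δ) (hδ1 : δ ≤ 1)
    (hS : ∀ t ≤ T, ‖S.op t‖ ≤ C) (hR : ∀ t ≤ T, ‖R.op t‖ ≤ C)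
    {F F' : V} {h : ℝ≥0} (hh : 0 < h) (hhδ : h ≤ δ)
    (hF : ∀ s ≤ h, ‖S.op s F - F‖ ≤ δ) (hF' : ∀ s ≤ h, ‖S.op s F' - F'‖ ≤ δ)
    (hq : ‖(((h : ℝ) : 𝕜))⁻¹ • (S.op h F - F) - F'‖ ≤ δ)
    {v v' : ℕ → W} (hv : ∀ k, R.InGraph (v k) (v' k))
    (h₁ : ∀ k ≤ ⌊T / h⌋₊, ‖(S.op (k * h) F : Z) - v k‖ ≤ δ * h)
    (h₂ : ∀ k ≤ ⌊T / h⌋₊, ‖(S.op (k * h) F' : Z) - v' k‖ ≤ δ)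
    {t : ℝ≥0} (ht : t ≤ T) :
    ‖(R.op t (v 0) : Z) - (S.op t F : Z)‖ ≤
      (7 * C ^ 3 * T * C + C * (C * ‖F'‖ + 1) + 1 + C) * δ := by
  have hh' : (0 : ℝ) < h := hh
  have hC0 : 0 ≤ C := by linarith
  have hn : ∀ k ≤ ⌊T / h⌋₊, k * h ≤ T := fun k hk => by
    rw [← le_div_iff₀ hh]
    exact (Nat.cast_le.2 hk).trans (Nat.floor_le zero_le)
  -- The Euler defect is at most `(C + 3) δ h` and the change of the images at most `(C + 2) δ`; `1
  -- ≤ C` turns these into `4 C δ h` and `3 C δ`. The tolerance `δ * h` in `h₁` is what keeps the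
  -- defect proportional to `h`.
  have hstep : ∀ k < ⌊T / h⌋₊, ‖R.op h (v k) - v (k + 1)‖ ≤ C * (4 * C * δ + 3 * C * δ) * h := by
    intro k hk
    have hkT := hn k hk.le
    have hhT : h ≤ T := by
      have := hn 1 (by omega)
      simpa using this
    have e : ((k + 1 : ℕ) : ℝ≥0) * h = k * h + h := by push_cast; ring
    have a1 := h₁ k hk.le
    have a2 := h₁ (k + 1) hk
    have b1 := h₂ k hk.le
    have b2 := h₂ (k + 1) hk
    rw [e, C0Semigroup.op_add_apply] at a2 b2
    refine (hv k).norm_op_sub_le (hv (k + 1)) hh (fun s hs => hR s (hs.trans hhT)) ?_ ?_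
    · have c1 : ‖S.op (k * h) (S.op h F) - S.op (k * h) F -
          ((h : ℝ) : 𝕜) • S.op (k * h) F'‖ ≤ C * (h * δ) := by
        rw [← map_smul, ← map_sub, ← map_sub]
        refine ((S.op _).le_opNorm _).trans (mul_le_mul (hS _ hkT) ?_ (norm_nonneg _) hC0)
        have hne : (((h : ℝ) : 𝕜)) ≠ 0 := by exact_mod_cast hh'.ne'
        have : S.op h F - F - ((h : ℝ) : 𝕜) • F' =
            ((h : ℝ) : 𝕜) • ((((h : ℝ) : 𝕜))⁻¹ • (S.op h F - F) - F') := by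
          rw [smul_sub, smul_inv_smul₀ hne]
        rw [this, norm_smul, RCLike.norm_ofReal, abs_of_pos hh']
        gcongr
      have c2 : ‖((h : ℝ) : 𝕜) • ((S.op (k * h) F' : Z) - v' k)‖ ≤ h * δ := by
        rw [norm_smul, RCLike.norm_ofReal, abs_of_pos hh']
        gcongr
      have c3 : ((v (k + 1) - v k - ((h : ℝ) : 𝕜) • v' k : W) : Z) =
          ((S.op (k * h) (S.op h F) - S.op (k * h) F - ((h : ℝ) : 𝕜) • S.op (k * h) F' : V) : Z)
          - ((S.op (k * h) (S.op h F) : Z) - v (k + 1)) + ((S.op (k * h) F : Z) - v k)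
          + ((h : ℝ) : 𝕜) • ((S.op (k * h) F' : Z) - v' k) := by
        push_cast
        rw [smul_sub]
        abel
      rw [Submodule.coe_norm, c3]
      refine (norm_add_le _ _).trans ?_
      refine (add_le_add_left ((norm_add_le _ _).trans
        (add_le_add_left (norm_sub_le _ _) _)) _).trans ?_
      rw [← Submodule.coe_norm]
      have : 0 ≤ (C - 1) * (δ * h) := mul_nonneg (by linarith) (by positivity)
      nlinarith
    · have c1 : ‖S.op (k * h) (S.op h F') - S.op (k * h) F'‖ ≤ C * δ := by
        rw [← map_sub]
        exact ((S.op _).le_opNorm _).trans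
          (mul_le_mul (hS _ hkT) (hF' h le_rfl) (norm_nonneg _) hC0)
      have c3 : ((v' (k + 1) - v' k : W) : Z) =
          ((S.op (k * h) (S.op h F') - S.op (k * h) F' : V) : Z)
          - ((S.op (k * h) (S.op h F') : Z) - v' (k + 1)) + ((S.op (k * h) F' : Z) - v' k) := by
        push_cast
        abel
      rw [Submodule.coe_norm, c3]
      refine (norm_add_le _ _).trans ((add_le_add_left (norm_sub_le _ _) _).trans ?_)
      rw [← Submodule.coe_norm]
      nlinarith
  set k := ⌊t / h⌋₊ with hk
  have hkn : k ≤ ⌊T / h⌋₊ := Nat.floor_le_floor (by gcongr)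
  have hkt : k * h ≤ t := by
    rw [← le_div_iff₀ hh]; exact Nat.floor_le zero_le
  obtain ⟨s, hs⟩ := exists_add_of_le hkt
  have hsh : s ≤ h := by
    have := (Nat.lt_floor_add_one (t / h)).le
    rw [div_le_iff₀ hh, ← hk, hs, add_mul, one_mul] at this
    exact le_of_add_le_add_left this
  have hsT : s ≤ T := le_trans (by rw [hs]; exact le_add_self) ht
  have hkT := hn k hkn
  have A := R.norm_op_mul_sub_le hR k hkT v fun j hj => hstep j (hj.trans_le hkn)
  have hkT' : (k : ℝ) * h ≤ T := by exact_mod_cast hkT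
  have A1 : ‖R.op (k * h) (v 0) - v k‖ ≤ 7 * C ^ 3 * T * δ := by
    refine A.trans ?_
    calc (k : ℝ) * (C * (C * (4 * C * δ + 3 * C * δ) * h)) = 7 * C ^ 3 * (k * h) * δ := by ring
      _ ≤ _ := by gcongr
  have A2 : ‖R.op s (R.op (k * h) (v 0) - v k)‖ ≤ C * (7 * C ^ 3 * T * δ) :=
    ((R.op _).le_opNorm _).trans (mul_le_mul (hR _ hsT) A1 (norm_nonneg _) hC0)
  have A3 : ‖R.op s (v k) - v k‖ ≤ C * (C * ‖F'‖ + 1) * δ := by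
    refine ((hv k).norm_op_sub_self_le fun r hr => hR r (hr.trans hsT)).trans ?_
    have e1 : ‖v' k‖ ≤ C * ‖F'‖ + 1 := by
      have e2 : ‖S.op (k * h) F'‖ ≤ C * ‖F'‖ :=
        ((S.op _).le_opNorm _).trans (by gcongr; exact hS _ hkT)
      have e3 := h₂ k hkn
      have e4 := norm_sub_norm_le (v' k : Z) (S.op (k * h) F' : Z)
      rw [norm_sub_rev, ← Submodule.coe_norm, ← Submodule.coe_norm] at e4
      linarith
    have e2 : (s : ℝ) ≤ δ := le_trans (by exact_mod_cast hsh) hhδ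
    gcongr
  have A4 : ‖S.op (k * h) (S.op s F - F)‖ ≤ C * δ :=
    ((S.op _).le_opNorm _).trans (mul_le_mul (hS _ hkT) (hF s hsh) (norm_nonneg _) hC0)
  have A5 : ‖(S.op (k * h) F : Z) - v k‖ ≤ δ := (h₁ k hkn).trans (by nlinarith)
  -- With `t = k h + s`, the four terms are the accumulated error, the motion of `v k` during time
  -- `s`, the error at the node, and the motion of `F` during time `s`.
  have key : (R.op t (v 0) : Z) - (S.op t F : Z) =
      (R.op s (R.op (k * h) (v 0) - v k) : W) + (R.op s (v k) - v k : W)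
      - ((S.op (k * h) F : Z) - v k) - (S.op (k * h) (S.op s F - F) : V) := by
    rw [hs, C0Semigroup.op_add_apply S, add_comm _ s, C0Semigroup.op_add_apply R, map_sub, map_sub]
    push_cast
    abel
  rw [key]
  refine (norm_sub_le _ _).trans ((add_le_add_left ((norm_sub_le _ _).trans
    (add_le_add_left (norm_add_le _ _) _)) _).trans ?_)
  simp only [← Submodule.coe_norm]
  linarith

/-- Stable and consistent approximations converge for data in the domain of the generator. -/
lemma GraphConsistent.orbitsConverge_of_inGraph (hc : GraphConsistent S Sm) {C : ℝ} (hC1 : 1 ≤ C)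
    (hS : ∀ t ≤ T, ‖S.op t‖ ≤ C) (hSm : ∀ m, ∀ t ≤ T, ‖(Sm m).op t‖ ≤ C)
    {F F' : V} (hFF' : S.InGraph F F') :
    ∀ ε > 0, ∃ p : ∀ m, Vm m, Tendsto (fun m => ‖(F : Z) - (p m : Z)‖) atTop (𝓝 0) ∧
      ∀ᶠ m in atTop, ∀ t ≤ T, ‖((Sm m).op t (p m) : Z) - (S.op t F : Z)‖ ≤ ε := by
  intro ε hε
  set D : ℝ := 7 * C ^ 3 * T * C + C * (C * ‖F'‖ + 1) + 1 + C with hD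
  have hD0 : 0 < D := by positivity
  set δ : ℝ := min 1 (ε / D) with hδdef
  have hδ : 0 < δ := lt_min one_pos (by positivity)
  obtain ⟨r1, hr1, H1⟩ := S.exists_norm_op_sub_le F hδ
  obtain ⟨r2, hr2, H2⟩ := S.exists_norm_op_sub_le F' hδ
  obtain ⟨r3, hr3, H3⟩ := hFF'.exists_norm_quotient_sub_le hδ
  set h : ℝ≥0 := min (min r1 r2) (min r3 δ.toNNReal) with hhdef
  have hh : 0 < h := lt_min (lt_min hr1 hr2) (lt_min hr3 (by simpa using hδ))
  have hr1' : h ≤ r1 := (min_le_left _ _).trans (min_le_left _ _)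
  have hr2' : h ≤ r2 := (min_le_left _ _).trans (min_le_right _ _)
  have hr3' : h ≤ r3 := (min_le_right _ _).trans (min_le_left _ _)
  have hhδ : (h : ℝ) ≤ δ := (Real.le_toNNReal_iff_coe_le hδ.le).1
    ((min_le_right _ _).trans (min_le_right _ _))
  -- The domain is invariant under `S`, so consistency applies at every node. As `h` is fixed before
  -- `m`, only finitely many nodes have to be controlled.
  have hcon : ∀ k : ℕ, _ := fun k => hc _ _ (hFF'.op (k * h))
  choose p p' hpp' hp hp' using hcon
  refine ⟨p 0, ?_, ?_⟩
  · simpa [C0Semigroup.op_zero_apply] using hp 0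
  have hh' : (0 : ℝ) < h := hh
  have E1 : ∀ᶠ m in atTop, ∀ k ∈ Finset.range (⌊T / h⌋₊ + 1),
      ‖(S.op (k * h) F : Z) - p k m‖ ≤ δ * h :=
    (Finset.eventually_all _).2 fun k _ => (hp k).eventually_le_const (by positivity)
  have E2 : ∀ᶠ m in atTop, ∀ k ∈ Finset.range (⌊T / h⌋₊ + 1),
      ‖(S.op (k * h) F' : Z) - p' k m‖ ≤ δ :=
    (Finset.eventually_all _).2 fun k _ => (hp' k).eventually_le_const hδ
  filter_upwards [E1, E2] with m h1 h2 t ht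
  refine (norm_op_sub_op_le (Sm m) hC1 hδ (min_le_left _ _) hS (hSm m) hh hhδ
    (fun s hs => H1 s (hs.trans hr1')) (fun s hs => H2 s (hs.trans hr2')) (H3 h hh hr3')
    (fun k => hpp' k m) (fun k hk => h1 k (Finset.mem_range.2 (by omega)))
    (fun k hk => h2 k (Finset.mem_range.2 (by omega))) ht).trans ?_
  calc D * δ ≤ D * (ε / D) := by gcongr; exact min_le_right _ _
    _ = ε := by field_simp

/-- Stable and consistent approximations converge. -/
theorem GraphConsistent.orbitsConverge [CompleteSpace V] (hc : GraphConsistent S Sm) {C : ℝ}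
    (hSm : ∀ m, ∀ t ≤ T, ‖(Sm m).op t‖ ≤ C) {F : V} {Fm : ∀ m, Vm m}
    (hF : Tendsto (fun m => ‖(Fm m : Z) - (F : Z)‖) atTop (𝓝 0)) :
    OrbitsConverge T S Sm F Fm := by
  obtain ⟨C', hS⟩ := S.exists_norm_op_le T
  set D : ℝ := max 1 (max C C') with hD
  have hD1 : 1 ≤ D := le_max_left _ _
  have hSm' : ∀ m, ∀ t ≤ T, ‖(Sm m).op t‖ ≤ D := fun m t ht =>
    (hSm m t ht).trans ((le_max_left _ _).trans (le_max_right _ _))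
  have hS' : ∀ t ≤ T, ‖S.op t‖ ≤ D := fun t ht =>
    (hS t ht).trans ((le_max_right _ _).trans (le_max_right _ _))
  intro ε hε
  -- The data differ from the polygon's data by `3 δ`, and `G` from `F` by `δ`, each amplified by
  -- `D`; the middle error is at most `δ ≤ D δ`.
  set δ : ℝ := ε / (5 * D) with hδdef
  have hδ : 0 < δ := by positivity
  obtain ⟨G, G', hGG', hG⟩ := S.exists_inGraph_norm_sub_le F hδ
  obtain ⟨p, hp, hconv⟩ := hc.orbitsConverge_of_inGraph hD1 hS' hSm' hGG' δ hδ
  filter_upwards [hconv, hp.eventually_le_const hδ, hF.eventually_le_const hδ] with m h1 h2 h3 t ht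
  have e1 : ‖Fm m - p m‖ ≤ 3 * δ := by
    have : ((Fm m - p m : Vm m) : Z) = ((Fm m : Z) - F) - ((G - F : V) : Z) + ((G : Z) - p m) := by
      push_cast; abel
    rw [Submodule.coe_norm, this]
    refine (norm_add_le _ _).trans ((add_le_add_left (norm_sub_le _ _) _).trans ?_)
    rw [← Submodule.coe_norm]
    linarith
  have e2 : ‖(Sm m).op t (Fm m - p m)‖ ≤ D * (3 * δ) :=
    (((Sm m).op t).le_opNorm _).trans (mul_le_mul (hSm' m t ht) e1 (norm_nonneg _) (by linarith))
  have e3 : ‖S.op t (G - F)‖ ≤ D * δ :=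
    ((S.op t).le_opNorm _).trans (mul_le_mul (hS' t ht) hG (norm_nonneg _) (by linarith))
  have e4 : ((Sm m).op t (Fm m) : Z) - (S.op t F : Z) = ((Sm m).op t (Fm m - p m) : Vm m)
      + (((Sm m).op t (p m) : Z) - (S.op t G : Z)) + (S.op t (G - F) : V) := by
    rw [map_sub, map_sub]; push_cast; abel
  rw [e4]
  refine (norm_add_le _ _).trans ((add_le_add_left (norm_add_le _ _) _).trans ?_)
  simp only [← Submodule.coe_norm]
  have e5 : 5 * D * δ = ε := by rw [hδdef]; field_simp
  nlinarith [h1 t ht]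

/-- If for each `F` some approximating data have convergent orbits, the approximation is
consistent. -/
theorem graphConsistent_of_orbitsConverge [∀ m, CompleteSpace (Vm m)] (hT : 0 < T)
    (h : ∀ F : V, ∃ Fm : ∀ m, Vm m, OrbitsConverge T S Sm F Fm) : GraphConsistent S Sm := by
  intro F F' hFF'
  obtain ⟨G, hG⟩ := h F
  let α : ℕ → Type _ := fun m => {q : Vm m × Vm m // (Sm m).InGraph q.1 q.2}
  let d : ∀ m, α m → ℝ := fun m q => ‖(F : Z) - (q.1.1 : Z)‖ + ‖(F' : Z) - (q.1.2 : Z)‖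
  have : ∀ m, Nonempty (α m) := fun m =>
    ⟨⟨(0, 0), by simp [C0Semigroup.InGraph]⟩⟩
  have hd : ∀ ε > 0, ∀ᶠ m in atTop, ∃ a, d m a ≤ ε := by
    intro ε hε
    set δ := ε / 7 with hδdef
    have hδ : 0 < δ := by positivity
    obtain ⟨r1, hr1, H1⟩ := S.exists_norm_op_sub_le F hδ
    obtain ⟨r2, hr2, H2⟩ := hFF'.exists_norm_quotient_sub_le hδ
    set h : ℝ≥0 := min T (min r1 r2) with hhdef
    have hh : 0 < h := lt_min hT (lt_min hr1 hr2)
    have hhT : h ≤ T := min_le_left _ _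
    have hr1' : h ≤ r1 := (min_le_right _ _).trans (min_le_left _ _)
    have hr2' : h ≤ r2 := (min_le_right _ _).trans (min_le_right _ _)
    have hh' : (0 : ℝ) < h := hh
    -- The difference quotient divides orbit errors by `h`, hence the tolerance `δ * h`. The final
    -- errors are `4 δ` for the time average and `3 δ` for its image.
    filter_upwards [hG (min δ (δ * h)) (lt_min hδ (by positivity))] with m hm
    have hm1 : ∀ t ≤ T, ‖((Sm m).op t (G m) : Z) - (S.op t F : Z)‖ ≤ δ := fun t ht =>
      (hm t ht).trans (min_le_left _ _)
    have hm2 : ∀ t ≤ T, ‖((Sm m).op t (G m) : Z) - (S.op t F : Z)‖ ≤ δ * h := fun t ht =>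
      (hm t ht).trans (min_le_right _ _)
    have h0 := hm1 0 zero_le
    have h0' := hm2 0 zero_le
    rw [C0Semigroup.op_zero_apply, C0Semigroup.op_zero_apply] at h0 h0'
    have hη : ∀ s ≤ h, ‖(Sm m).op s (G m) - G m‖ ≤ 3 * δ := by
      intro s hs
      have e : (((Sm m).op s (G m) - G m : Vm m) : Z) =
          (((Sm m).op s (G m) : Z) - (S.op s F : Z)) + ((S.op s F - F : V) : Z)
          - ((G m : Z) - F) := by push_cast; abel
      rw [Submodule.coe_norm, e]
      refine (norm_sub_le _ _).trans ((add_le_add_left (norm_add_le _ _) _).trans ?_)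
      rw [← Submodule.coe_norm]
      linarith [hm1 s (hs.trans hhT), H1 s (hs.trans hr1')]
    obtain ⟨y, hy, hy'⟩ := (Sm m).exists_inGraph_near (G m) hh hη
    refine ⟨⟨(y, _), hy'⟩, ?_⟩
    have e1 : ‖(F : Z) - y‖ ≤ 4 * δ := by
      have e : (F : Z) - y = -(((G m : Z) - F) + ((y - G m : Vm m) : Z)) := by push_cast; abel
      rw [e, norm_neg]
      refine (norm_add_le _ _).trans ?_
      rw [← Submodule.coe_norm]
      linarith
    have e2 : ‖(F' : Z) - (((((h : ℝ) : 𝕜))⁻¹ • ((Sm m).op h (G m) - G m) : Vm m) : Z)‖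
        ≤ 3 * δ := by
      have e : (F' : Z) - (((((h : ℝ) : 𝕜))⁻¹ • ((Sm m).op h (G m) - G m) : Vm m) : Z) =
          -((((((h : ℝ) : 𝕜))⁻¹ • (S.op h F - F) - F' : V) : Z) + (((h : ℝ) : 𝕜))⁻¹ •
          ((((Sm m).op h (G m) : Z) - (S.op h F : Z)) - ((G m : Z) - F))) := by
        push_cast
        simp only [smul_sub]
        abel
      rw [e, norm_neg]
      refine (norm_add_le _ _).trans ?_
      rw [norm_smul, norm_inv, RCLike.norm_ofReal, abs_of_pos hh', ← Submodule.coe_norm]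
      have e3 : (h : ℝ)⁻¹ * ‖(((Sm m).op h (G m) : Z) - (S.op h F : Z)) - ((G m : Z) - F)‖
          ≤ 2 * δ := by
        rw [inv_mul_le_iff₀ hh']
        refine (norm_sub_le _ _).trans ?_
        linarith [hm2 h hhT]
      linarith [H2 h hh hr2']
    have e3 : 7 * δ = ε := by rw [hδdef]; ring
    change ‖(F : Z) - y‖ + ‖(F' : Z) -
      (((((h : ℝ) : 𝕜))⁻¹ • ((Sm m).op h (G m) - G m) : Vm m) : Z)‖ ≤ ε
    linarith
  obtain ⟨a, ha⟩ := exists_seq_tendsto_zero d (fun m q => by positivity) hd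
  exact ⟨fun m => (a m).1.1, fun m => (a m).1.2, fun m => (a m).2,
    squeeze_zero (fun _ => norm_nonneg _) (fun m => le_add_of_nonneg_right (norm_nonneg _)) ha,
    squeeze_zero (fun _ => norm_nonneg _) (fun m => le_add_of_nonneg_left (norm_nonneg _)) ha⟩

/-- If all null sequences of data have orbits bounded by `1` eventually, the semigroups are
eventually uniformly bounded on `[0, T]`. -/
lemma exists_eventually_norm_op_le
    (h : ∀ Fm : ∀ m, Vm m, Tendsto (fun m => ‖Fm m‖) atTop (𝓝 0) →
      ∀ᶠ m in atTop, ∀ t ≤ T, ‖(Sm m).op t (Fm m)‖ ≤ 1) :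
    ∃ C, ∀ᶠ m in atTop, ∀ t ≤ T, ‖(Sm m).op t‖ ≤ C := by
  by_contra! hcon
  let P : ℕ → ℕ → Prop := fun n m => ∃ x : Vm m, ‖x‖ ≤ 1 / ((n : ℝ) + 1) ∧
    ∃ t ≤ T, 1 < ‖(Sm m).op t x‖
  have hP : ∀ n, ∃ᶠ m in atTop, P n m := by
    intro n
    refine (hcon ((n : ℝ) + 1)).mono fun m hm => ?_
    obtain ⟨t, ht, hlt⟩ := hm
    obtain ⟨x, hx1, hx2⟩ := ((Sm m).op t).exists_lt_apply_of_lt_opNorm hlt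
    have hn : (0 : ℝ) < (n : ℝ) + 1 := by positivity
    have hnorm : ‖(((n : ℝ) + 1 : ℝ) : 𝕜)⁻¹‖ = ((n : ℝ) + 1)⁻¹ := by
      rw [norm_inv, RCLike.norm_ofReal, abs_of_pos hn]
    refine ⟨(((n : ℝ) + 1 : ℝ) : 𝕜)⁻¹ • x, ?_, t, ht, ?_⟩
    · rw [norm_smul, hnorm, one_div]
      exact mul_le_of_le_one_right (by positivity) hx1.le
    · rw [map_smul, norm_smul, hnorm, ← div_eq_inv_mul, lt_div_iff₀ hn, one_mul]
      exact hx2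
  obtain ⟨φ, hφ, hPφ⟩ := extraction_forall_of_frequently hP
  -- The rescaled bad vectors sit at the indices `φ k`; padding with `0` elsewhere makes a full null
  -- sequence that violates the bound `1` infinitely often.
  have hx : ∀ m, ∃ x : Vm m, (∀ k, φ k = m → ‖x‖ ≤ 1 / ((k : ℝ) + 1) ∧
      ∃ t ≤ T, 1 < ‖(Sm m).op t x‖) ∧ ((¬ ∃ k, φ k = m) → x = 0) := by
    intro m
    by_cases hm : ∃ k, φ k = m
    · obtain ⟨k, rfl⟩ := hm
      obtain ⟨x, hx⟩ := hPφ k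
      refine ⟨x, fun j hj => ?_, fun h => (h ⟨k, rfl⟩).elim⟩
      rw [hφ.injective hj]
      exact hx
    · exact ⟨0, fun k hk => (hm ⟨k, hk⟩).elim, fun _ => rfl⟩
  choose x hx1 hx2 using hx
  have hlim : Tendsto (fun m => ‖x m‖) atTop (𝓝 0) := by
    refine Metric.tendsto_atTop.2 fun ε hε => ?_
    obtain ⟨n, hn⟩ := exists_nat_one_div_lt hε
    refine ⟨φ n, fun m hm => ?_⟩
    rw [dist_zero_right, norm_norm]
    by_cases hk : ∃ k, φ k = m
    · obtain ⟨k, hk⟩ := hk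
      refine ((hx1 m k hk).1.trans ?_).trans_lt hn
      have : n ≤ k := hφ.le_iff_le.1 (by rwa [hk])
      exact one_div_le_one_div_of_le (by positivity) (by gcongr)
    · rw [hx2 m hk, norm_zero]; exact hε
  obtain ⟨k, hk⟩ := (hφ.tendsto_atTop.eventually (h x hlim)).exists
  obtain ⟨t, ht, hlt⟩ := (hx1 (φ k) k rfl).2
  exact absurd (hk t ht) (not_le.2 hlt)

/-- The finitely many exceptional semigroups are each bounded on `[0, T]` by Banach–Steinhaus. -/
lemma exists_norm_op_le_of_eventually [∀ m, CompleteSpace (Vm m)]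
    (h : ∃ C, ∀ᶠ m in atTop, ∀ t ≤ T, ‖(Sm m).op t‖ ≤ C) :
    ∃ C, ∀ m, ∀ t ≤ T, ‖(Sm m).op t‖ ≤ C := by
  obtain ⟨C, hC⟩ := h
  obtain ⟨D, hD⟩ := exists_bound_of_eventually
    (f := fun m (t : {t : ℝ≥0 // t ≤ T}) => ‖(Sm m).op t‖)
    ⟨C, hC.mono fun m hm t => hm t t.2⟩ fun m => by
      obtain ⟨c, hc⟩ := (Sm m).exists_norm_op_le T
      exact ⟨c, fun t => hc t t.2⟩
  exact ⟨D, fun m t ht => hD m ⟨t, ht⟩⟩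

theorem stable_of_norm_op_le (hT : 0 < T) {C : ℝ} (h : ∀ m, ∀ t ≤ T, ‖(Sm m).op t‖ ≤ C) :
    Stable Sm :=
  ⟨max 1 C, Real.log (max 1 C) / T, fun m t => (Sm m).norm_op_le_exp hT (le_max_left _ _)
    (fun s hs => (h m s hs).trans (le_max_right _ _)) t⟩

lemma Stable.exists_norm_op_le (h : Stable Sm) (T : ℝ≥0) :
    ∃ C, ∀ m, ∀ t ≤ T, ‖(Sm m).op t‖ ≤ C := by
  obtain ⟨M, ω, h⟩ := h
  refine ⟨|M| * Real.exp (|ω| * T), fun m t ht => (h m t).trans ?_⟩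
  have ht' : (t : ℝ) ≤ T := ht
  have : ω * t ≤ |ω| * T := (mul_le_mul_of_nonneg_right (le_abs_self ω) t.2).trans
    (mul_le_mul_of_nonneg_left ht' (abs_nonneg _))
  exact mul_le_mul (le_abs_self M) (Real.exp_le_exp.2 this) (Real.exp_pos _).le (abs_nonneg _)

/-- Uniform boundedness of the semigroups when the approximating data are obtained through
bounded operators `B m` that are norm-preserving quotient maps up to representatives. -/
theorem exists_norm_op_le_of_orbitsConverge [CompleteSpace V] [∀ m, CompleteSpace (Vm m)]
    (B : ∀ m, V →L[𝕜] Vm m)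
    (hconv : ∀ F : V, ∃ Fm : ∀ m, Vm m, OrbitsConverge T S Sm F Fm ∧
      ∀ᶠ m in atTop, Fm m = B m F)
    (hsurj : ∀ᶠ m in atTop, ∀ y : Vm m, ∃ z : V, ‖z‖ ≤ ‖y‖ ∧ B m z = y) :
    ∃ C, ∀ m, ∀ t ≤ T, ‖(Sm m).op t‖ ≤ C := by
  -- All operators share the domain `V` and target `Z`, so one application of Banach–Steinhaus is
  -- uniform in both `m` and `t`. Norm-controlled preimages under `B m` then remove `B m`.
  let g : ℕ × {t : ℝ≥0 // t ≤ T} → V →L[𝕜] Z := fun i =>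
    (Vm i.1).subtypeL.comp (((Sm i.1).op i.2).comp (B i.1))
  obtain ⟨C, hC⟩ : ∃ C, ∀ i, ‖g i‖ ≤ C := by
    refine banach_steinhaus fun F => ?_
    obtain ⟨Fm, hF, hFB⟩ := hconv F
    obtain ⟨c, hc⟩ := S.exists_norm_op_le T
    obtain ⟨D, hD⟩ := exists_bound_of_eventually
      (f := fun m (t : {t : ℝ≥0 // t ≤ T}) => ‖(Sm m).op t (B m F)‖)
      ⟨1 + c * ‖F‖, by
        filter_upwards [hF 1 one_pos, hFB] with m h1 h2 t
        have e1 := h1 t t.2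
        have e2 := norm_sub_norm_le ((Sm m).op t (Fm m) : Z) (S.op t F : Z)
        have e3 : ‖S.op t F‖ ≤ c * ‖F‖ :=
          ((S.op t).le_opNorm _).trans (by gcongr; exact hc t t.2)
        rw [← h2]
        simp only [← Submodule.coe_norm] at e2
        linarith⟩
      fun m => by
        obtain ⟨c, hc⟩ := (Sm m).exists_norm_op_le T
        exact ⟨c * ‖B m F‖, fun t =>
          (((Sm m).op t).le_opNorm _).trans (by gcongr; exact hc t t.2)⟩
    exact ⟨D, fun i => hD i.1 i.2⟩
  have hC0 : 0 ≤ C := (norm_nonneg _).trans (hC (0, ⟨0, zero_le⟩))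
  refine exists_norm_op_le_of_eventually ⟨C, ?_⟩
  filter_upwards [hsurj] with m hm t ht
  refine ContinuousLinearMap.opNorm_le_bound _ hC0 fun y => ?_
  obtain ⟨z, hz, rfl⟩ := hm y
  have e : ‖(Sm m).op t (B m z)‖ = ‖g (m, ⟨t, ht⟩) z‖ := rfl
  rw [e]
  exact ((g _).le_opNorm z).trans (mul_le_mul (hC _) hz (norm_nonneg _) hC0)

end Approximation

end FDE

/-! ### Functionals on a compact set -/

namespace FDE

section OnK

variable {𝕜 : Type*} [RCLike 𝕜] {X : Type*} [NormedAddCommGroup X] [NormedSpace ℝ X]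
  {K : Compacts X} {A : Submodule 𝕜 C(X, 𝕜)} {Am : ℕ → Submodule 𝕜 C(X, 𝕜)}

/-- The basis projections converge to the identity uniformly on compact sets. -/
lemma eventually_norm_basisProj_sub_le [CompleteSpace X] (b : SchauderBasis ℝ X) (K : Compacts X)
    {ε : ℝ} (hε : 0 < ε) :
    ∀ᶠ m in atTop, ∀ x ∈ K, ‖basisProj b m x - x‖ ≤ ε := by
  obtain ⟨C, hC⟩ := b.exists_norm_proj_le
  have hC0 : 0 ≤ C := (norm_nonneg _).trans (hC 0)
  have hP : ∀ m, basisProj b m = b.proj m := fun m => rfl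
  set δ := ε / (C + 2) with hδ
  have hδ0 : 0 < δ := by positivity
  obtain ⟨s, hs, hcov⟩ := Metric.totallyBounded_iff.1 K.isCompact.totallyBounded δ hδ0
  have h1 : ∀ᶠ m in atTop, ∀ y ∈ s, ‖basisProj b m y - y‖ ≤ δ := by
    refine (eventually_all_finite hs).2 fun y _ => ?_
    have := (tendsto_iff_norm_sub_tendsto_zero.1 (b.tendsto_proj y)).eventually_le_const hδ0
    simpa only [hP] using this
  filter_upwards [h1] with m hm x hx
  obtain ⟨y, hy, hxy⟩ := Set.mem_iUnion₂.1 (hcov hx)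
  rw [Metric.mem_ball, dist_eq_norm] at hxy
  have e : basisProj b m x - x = basisProj b m (x - y) + (basisProj b m y - y) - (x - y) := by
    rw [map_sub]; abel
  have e1 : ‖basisProj b m (x - y)‖ ≤ C * δ :=
    ((basisProj b m).le_opNorm _).trans (mul_le_mul (hC m) hxy.le (norm_nonneg _) hC0)
  have e2 : (C + 2) * δ = ε := by rw [hδ]; field_simp
  rw [e]
  refine (norm_sub_le _ _).trans ((add_le_add_left (norm_add_le _ _) _).trans ?_)
  linarith [hm y hy]

/-- `B_m F → F` uniformly on `K`. -/
lemma tendsto_restrictL_cylApprox [CompleteSpace X] (b : SchauderBasis ℝ X) (K : Compacts X)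
    (F : C(X, 𝕜)) :
    Tendsto (fun m => ‖restrictL 𝕜 K (cylApprox b m F) - restrictL 𝕜 K F‖) atTop (𝓝 0) := by
  refine tendsto_order.2 ⟨fun e he => Eventually.of_forall fun m =>
    he.trans_le (norm_nonneg _), fun e he => ?_⟩
  -- The point `P_m θ` may leave `K`, so uniform continuity of `F` on `K` alone is not enough: the
  -- second point must range over `X`.
  have h1 := K.isCompact.uniformContinuousAt_of_continuousAt F
    (fun x _ => F.continuous.continuousAt) (Metric.dist_mem_uniformity (half_pos he))
  obtain ⟨δ, hδ, h2⟩ := Metric.mem_uniformity_dist.1 h1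
  filter_upwards [eventually_norm_basisProj_sub_le b K (half_pos hδ)] with m hm
  refine lt_of_le_of_lt ((ContinuousMap.norm_le _ (half_pos he).le).2 fun x => ?_) (half_lt_self he)
  have h3 : dist (x : X) (basisProj b m x) < δ := by
    rw [dist_comm, dist_eq_norm]
    exact (hm x x.2).trans_lt (half_lt_self hδ)
  have h4 := h2 h3 x.2
  rw [Set.mem_ofPred_eq, dist_comm, dist_eq_norm] at h4
  exact h4.le

/-- A generator's graph is determined by its semigroup, so the partial operators can be dropped from
the argument. -/
lemma consistent_iff_graphConsistent {L : OnCompact K A →ₗ.[𝕜] OnCompact K A}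
    {S : C0Semigroup 𝕜 (OnCompact K A)} (hL : S.IsGenerator L)
    {Lm : ∀ m, OnCompact K (Am m) →ₗ.[𝕜] OnCompact K (Am m)}
    {Sm : ∀ m, C0Semigroup 𝕜 (OnCompact K (Am m))} (hLm : ∀ m, (Sm m).IsGenerator (Lm m)) :
    Consistent L Lm ↔ GraphConsistent S Sm := by
  constructor
  · intro h F F' hF
    obtain ⟨f, rfl, rfl⟩ := (LinearPMap.mem_graph_iff _).1 ((hL F F').2 hF)
    obtain ⟨p, h1, h2⟩ := h f
    exact ⟨fun m => p m, fun m => Lm m (p m),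
      fun m => (hLm m _ _).1 ((Lm m).mem_graph (p m)), h1, h2⟩
  · intro h F
    obtain ⟨p, p', hp, h1, h2⟩ := h _ _ ((hL _ _).1 (L.mem_graph F))
    have hg : ∀ m, ∃ f : (Lm m).domain, (f : OnCompact K (Am m)) = p m ∧ Lm m f = p' m :=
      fun m => (LinearPMap.mem_graph_iff _).1 ((hLm m _ _).2 (hp m))
    choose f hf hf' using hg
    refine ⟨f, ?_, ?_⟩
    · simpa only [hf] using h1
    · simpa only [hf'] using h2

lemma solutionsConverge_iff {T : ℝ≥0} {S : C0Semigroup 𝕜 (OnCompact K A)}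
    {Sm : ∀ m, C0Semigroup 𝕜 (OnCompact K (Am m))}
    {F0 : OnCompact K A} {Fm0 : ∀ m, OnCompact K (Am m)} :
    SolutionsConverge T S Sm F0 Fm0 ↔ OrbitsConverge T S Sm F0 Fm0 := by
  unfold SolutionsConverge
  rw [Metric.tendstoUniformlyOn_iff]
  constructor
  · intro h ε hε
    filter_upwards [h ε hε] with m hm t ht
    refine (ContinuousMap.norm_le _ hε.le).2 fun x => ?_
    have := hm (t, x) ⟨⟨zero_le, ht⟩, trivial⟩
    rw [dist_comm, dist_eq_norm] at this
    exact this.le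
  · intro h ε hε
    filter_upwards [h (ε / 2) (half_pos hε)] with m hm p hp
    rw [dist_comm, dist_eq_norm]
    have h1 := (ContinuousMap.norm_coe_le_norm
      (((Sm m).op p.1 (Fm0 m) : C(K, 𝕜)) - (S.op p.1 F0 : C(K, 𝕜))) p.2).trans (hm p.1 hp.1.2)
    exact h1.trans_lt (half_lt_self hε)

/-- If `B_m` is bounded for the norm of uniform convergence on `K`, it induces a bounded operator
between the spaces of functionals considered on `K`. -/
lemma exists_cylApprox_operator (b : SchauderBasis ℝ X) (m : ℕ) {A A' : Submodule 𝕜 C(X, 𝕜)}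
    (hB : ∀ F ∈ A, cylApprox b m F ∈ A') {C : ℝ}
    (hC : ∀ F ∈ A, ‖restrictL 𝕜 K (cylApprox b m F)‖ ≤ C * ‖restrictL 𝕜 K F‖) :
    ∃ B : OnCompact K A →L[𝕜] OnCompact K A', ∀ (F : C(X, 𝕜)) (hF : F ∈ A),
      B (toOnCompact K A F hF) = toOnCompact K A' (cylApprox b m F) (hB F hF) := by
  have hrep : ∀ F : OnCompact K A, ∃ G, ∃ hG : G ∈ A, toOnCompact K A G hG = F := by
    rintro ⟨_, G, hG, rfl⟩
    exact ⟨G, hG, rfl⟩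
  choose r hrA hr using hrep
  have hr' : ∀ F : OnCompact K A, restrictL 𝕜 K (r F) = F := fun F =>
    congrArg Subtype.val (hr F)
  -- Since `P_m` need not preserve `K`, agreement on `K` does not by itself pass to `B_m`; the bound
  -- applied to `G - H` forces it.
  have hwd : ∀ G ∈ A, ∀ H ∈ A, restrictL 𝕜 K G = restrictL 𝕜 K H →
      restrictL 𝕜 K (cylApprox b m G) = restrictL 𝕜 K (cylApprox b m H) := by
    intro G hG H hH h
    have h1 := hC (G - H) (A.sub_mem hG hH)
    rw [map_sub, h, sub_self, norm_zero, mul_zero] at h1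
    have h2 : cylApprox b m (G - H) = cylApprox b m G - cylApprox b m H := rfl
    rw [h2, map_sub] at h1
    exact sub_eq_zero.1 (norm_le_zero_iff.1 h1)
  let B₀ : OnCompact K A →ₗ[𝕜] OnCompact K A' :=
    { toFun := fun F => toOnCompact K A' (cylApprox b m (r F)) (hB _ (hrA F))
      map_add' := fun F G => Subtype.ext <|
        hwd _ (hrA _) _ (A.add_mem (hrA F) (hrA G)) (by rw [map_add, hr', hr', hr']; rfl)
      map_smul' := fun c F => Subtype.ext <|
        hwd _ (hrA _) _ (A.smul_mem c (hrA F)) (by rw [map_smul, hr', hr']; rfl) }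
  refine ⟨B₀.mkContinuous C fun F => ?_, fun F hF => Subtype.ext <| hwd _ (hrA _) _ hF (hr' _)⟩
  have := hC (r F) (hrA F)
  rwa [hr'] at this

lemma Convergent.cylConvergent [CompleteSpace X] (b : SchauderBasis ℝ X)
    (hB : ∀ m, ∀ F ∈ A, cylApprox b m F ∈ Am m) {T : ℝ≥0} {S : C0Semigroup 𝕜 (OnCompact K A)}
    {Sm : ∀ m, C0Semigroup 𝕜 (OnCompact K (Am m))} (h : Convergent T S Sm) :
    CylConvergent b hB T S Sm :=
  fun F0 _ => h _ _ (tendsto_restrictL_cylApprox b K F0)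

lemma CylConvergent.graphConsistent [∀ m, CompleteSpace (OnCompact K (Am m))]
    {b : SchauderBasis ℝ X} {hB : ∀ m, ∀ F ∈ A, cylApprox b m F ∈ Am m} {T : ℝ≥0} (hT : 0 < T)
    {S : C0Semigroup 𝕜 (OnCompact K A)} {Sm : ∀ m, C0Semigroup 𝕜 (OnCompact K (Am m))}
    (h : CylConvergent b hB T S Sm) : GraphConsistent S Sm := by
  refine graphConsistent_of_orbitsConverge hT ?_
  rintro ⟨_, F, hF, rfl⟩
  exact ⟨_, solutionsConverge_iff.1 (h F hF)⟩

lemma convergent_of_stable_of_graphConsistent [CompleteSpace (OnCompact K A)] (T : ℝ≥0)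
    {S : C0Semigroup 𝕜 (OnCompact K A)} {Sm : ∀ m, C0Semigroup 𝕜 (OnCompact K (Am m))}
    (hs : Stable Sm) (hc : GraphConsistent S Sm) : Convergent T S Sm := by
  obtain ⟨C, hC⟩ := hs.exists_norm_op_le T
  exact fun F0 Fm0 h => solutionsConverge_iff.2 (hc.orbitsConverge hC h)

lemma Convergent.stable [∀ m, CompleteSpace (OnCompact K (Am m))] {T : ℝ≥0} (hT : 0 < T)
    {S : C0Semigroup 𝕜 (OnCompact K A)} {Sm : ∀ m, C0Semigroup 𝕜 (OnCompact K (Am m))}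
    (h : Convergent T S Sm) : Stable Sm := by
  obtain ⟨C, hC⟩ := exists_norm_op_le_of_eventually
    (exists_eventually_norm_op_le (T := T) (Sm := Sm) fun Fm hFm => by
      have := solutionsConverge_iff.1 (h 0 Fm (by simpa using hFm)) 1 one_pos
      simpa using this)
  exact stable_of_norm_op_le hT hC

/-- For large `m`, a cylindrical functional is its own preimage under `B_m`, with the same norm, so
a bound on `Sm m t ∘ B_m` over `A` bounds `Sm m t` itself. -/
lemma CylConvergent.stable [CompleteSpace (OnCompact K A)]
    [∀ m, CompleteSpace (OnCompact K (Am m))]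
    {b : SchauderBasis ℝ X} (hcyl : ∀ m, ∀ F ∈ Am m, cylApprox b m F = F)
    {hB : ∀ m, ∀ F ∈ A, cylApprox b m F ∈ Am m} {T : ℝ≥0} (hT : 0 < T)
    {S : C0Semigroup 𝕜 (OnCompact K A)} {Sm : ∀ m, C0Semigroup 𝕜 (OnCompact K (Am m))}
    (hbdd : ∀ᶠ m in atTop, Am m ≤ A ∧ ∃ C : ℝ, ∀ F ∈ A,
      ‖restrictL 𝕜 K (cylApprox b m F)‖ ≤ C * ‖restrictL 𝕜 K F‖)
    (h : CylConvergent b hB T S Sm) : Stable Sm := by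
  have hex : ∀ m, ∃ B : OnCompact K A →L[𝕜] OnCompact K (Am m),
      (∃ C : ℝ, ∀ F ∈ A, ‖restrictL 𝕜 K (cylApprox b m F)‖ ≤ C * ‖restrictL 𝕜 K F‖) →
      ∀ (F : C(X, 𝕜)) (hF : F ∈ A),
        B (toOnCompact K A F hF) = toOnCompact K (Am m) (cylApprox b m F) (hB m F hF) := by
    intro m
    by_cases hm : ∃ C : ℝ, ∀ F ∈ A,
      ‖restrictL 𝕜 K (cylApprox b m F)‖ ≤ C * ‖restrictL 𝕜 K F‖
    · obtain ⟨C, hC⟩ := hm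
      obtain ⟨B, hB'⟩ := exists_cylApprox_operator b m (hB m) hC
      exact ⟨B, fun _ => hB'⟩
    · exact ⟨0, fun h => (hm h).elim⟩
  choose B hBF using hex
  obtain ⟨C, hC⟩ := exists_norm_op_le_of_orbitsConverge (T := T) (S := S) (Sm := Sm) B
    (by
      rintro ⟨_, F, hF, rfl⟩
      refine ⟨_, solutionsConverge_iff.1 (h F hF), ?_⟩
      filter_upwards [hbdd] with m hm
      exact (hBF m hm.2 F hF).symm)
    (by
      filter_upwards [hbdd] with m hm
      rintro ⟨_, G, hG, rfl⟩
      refine ⟨toOnCompact K A G (hm.1 hG), le_rfl, ?_⟩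
      rw [hBF m hm.2 G (hm.1 hG)]
      exact Subtype.ext (congrArg (restrictL 𝕜 K) (hcyl m G hG)))
  exact stable_of_norm_op_le hT hC

end OnK

end FDE

theorem mainTheorem2
    {𝕜 : Type*} [RCLike 𝕜] {X : Type*} [NormedAddCommGroup X] [NormedSpace ℝ X] [CompleteSpace X]
    -- a real Banach space with a basis, and a compact subset
    (b : SchauderBasis ℝ X) (K : TopologicalSpace.Compacts X)
    -- the spaces of functionals and of cylindrical functionals, Banach for the max norm over `K`
    (A : Submodule 𝕜 C(X, 𝕜)) [CompleteSpace (FDE.OnCompact K A)]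
    (Am : ℕ → Submodule 𝕜 C(X, 𝕜)) [∀ m, CompleteSpace (FDE.OnCompact K (Am m))]
    (hcyl : ∀ m, ∀ F ∈ Am m, FDE.cylApprox b m F = F)
    (hB : ∀ m, ∀ F ∈ A, FDE.cylApprox b m F ∈ Am m)
    -- the operators of the FDE and of the approximating PDEs, with their semigroups
    (L : FDE.OnCompact K A →ₗ.[𝕜] FDE.OnCompact K A)
    (S : FDE.C0Semigroup 𝕜 (FDE.OnCompact K A)) (hL : S.IsGenerator L)
    (Lm : ∀ m, FDE.OnCompact K (Am m) →ₗ.[𝕜] FDE.OnCompact K (Am m))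
    (Sm : ∀ m, FDE.C0Semigroup 𝕜 (FDE.OnCompact K (Am m))) (hLm : ∀ m, (Sm m).IsGenerator (Lm m))
    (T : NNReal) (hT : 0 < T) :
    (FDE.Stable Sm ∧ FDE.Consistent L Lm ↔ FDE.Convergent T S Sm) ∧
    (FDE.Stable Sm ∧ FDE.Consistent L Lm → FDE.CylConvergent b hB T S Sm) ∧
    ((∀ᶠ m in Filter.atTop, Am m ≤ A ∧ ∃ C : ℝ, ∀ F ∈ A,
        ‖FDE.restrictL 𝕜 K (FDE.cylApprox b m F)‖ ≤ C * ‖FDE.restrictL 𝕜 K F‖) →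
      FDE.CylConvergent b hB T S Sm → FDE.Stable Sm ∧ FDE.Consistent L Lm) := by
  have hcons := FDE.consistent_iff_graphConsistent hL hLm
  have hconv : FDE.Stable Sm ∧ FDE.Consistent L Lm → FDE.Convergent T S Sm := fun h =>
    FDE.convergent_of_stable_of_graphConsistent T h.1 (hcons.1 h.2)
  refine ⟨⟨hconv, fun h => ⟨h.stable hT, hcons.2 ?_⟩⟩, fun h => (hconv h).cylConvergent b hB,
    fun hbdd h => ⟨h.stable hcyl hT hbdd, hcons.2 (h.graphConsistent hT)⟩⟩
  -- Consistency needs some convergent data for each `F`; `B_m F` supplies them because `B_m F → F`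
  -- on `K`.
  exact (h.cylConvergent b hB).graphConsistent hT
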